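/- Theorem. Fix a countably infinite set of variables and a countably infinite set $\sigma_0$ of unary relation symbols, and let $\mathrm{succ}$, $<$ and $R$ be binary relation symbols. For a set $\tau$ of binary symbols, the one-dimensional fragment $\mathrm{F}_1$ over $\sigma_0\cup\tau$ is the smallest set of first-order formulas that contains all atoms over $\sigma_0\cup\tau$ and all equalities $x=y$, is closed under $\vee$ and $\neg$, and contains, for every $\varphi$ in it whose free variables are exactly the distinct variables $x_0,\dots,x_k$, the formulas $\exists x_0\dots x_k\,\varphi$ and $\exists x_1\dots x_k\,\varphi$. Consider structures that interpret $\sigma_0\cup\{\mathrm{succ},<,R\}$, with $R$ and the unary symbols interpreted arbitrarily. Such a structure is a word if it is finite and non-empty, $<$ is a strict linear order on it and $\mathrm{succ}$ is the successor relation induced by $<$; it is an $\omega$-word if its reduct to $\{\mathrm{succ},<\}$ is isomorphic to $(\mathbb{N},+1,<)$. Then each of the following four problems is undecidable: (1) given a sentence of $\mathrm{F}_1$ over $\sigma_0\cup\{\mathrm{succ},R\}$, decide whether it is true in some word; (2) given a sentence of $\mathrm{F}_1$ over $\sigma_0\cup\{\mathrm{succ},R\}$, decide whether it is true in some $\omega$-word;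 (3) given a sentence of $\mathrm{F}_1$ over $\sigma_0\cup\{<,R\}$, decide whether it is true in some word; (4) given a sentence of $\mathrm{F}_1$ over $\sigma_0\cup\{<,R\}$, decide whether it is true in some $\omega$-word. -/

import Mathlib

namespace OneDim

/-- The binary relation symbols: the navigational symbols `succ` and `less` of words, and one
further symbol `rel`, whose interpretation is arbitrary. -/
inductive BinSym : Type
  | succ : BinSym
  | less : BinSym
  | rel : BinSym

/-- First-order relational formulas with equality. Variables are natural numbers, and there is
an unlimited supply `P 0, P 1, …` of unary relation symbols. -/
inductive Formula : Type
  /-- `unary p x` is the atom `P p (x)`. -/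
  | unary : ℕ → ℕ → Formula
  /-- `bin s x y` is the atom `s(x, y)`. -/
  | bin : BinSym → ℕ → ℕ → Formula
  /-- `eq x y` is the atom `x = y`. -/
  | eq : ℕ → ℕ → Formula
  | or : Formula → Formula → Formula
  | neg : Formula → Formula
  /-- `ex x φ` is `∃ x, φ`. -/
  | ex : ℕ → Formula → Formula

namespace Formula

/-- The set of free variables. -/
def freeVars : Formula → Finset ℕ
  | unary _ x => {x}
  | bin _ x y => {x, y}
  | eq x y => {x, y}
  | or φ ψ => φ.freeVars ∪ ψ.freeVars
  | neg φ => φ.freeVars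
  | ex x φ => φ.freeVars.erase x

/-- The formula `∃ x₁ … xₖ, φ`, for a list `[x₁, …, xₖ]` of variables. -/
def exBlock (xs : List ℕ) (φ : Formula) : Formula :=
  xs.foldr ex φ

/-- The one-dimensional fragment over the signature consisting of all unary symbols and of the
binary symbols in `σ`: quantification is restricted to blocks of existential quantifiers that bind
all free variables, or all of them but one. -/
inductive IsOneDim (σ : Set BinSym) : Formula → Prop
  | unary (p x : ℕ) : IsOneDim σ (unary p x)
  | bin (s : BinSym) (hs : s ∈ σ) (x y : ℕ) : IsOneDim σ (bin s x y)
  | eq (x y : ℕ) : IsOneDim σ (eq x y)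
  | or (φ ψ : Formula) : IsOneDim σ φ → IsOneDim σ ψ → IsOneDim σ (or φ ψ)
  | neg (φ : Formula) : IsOneDim σ φ → IsOneDim σ (neg φ)
  | exAll (x₀ : ℕ) (xs : List ℕ) (φ : Formula) : IsOneDim σ φ →
      (x₀ :: xs).Nodup → (x₀ :: xs).toFinset = φ.freeVars → IsOneDim σ (exBlock (x₀ :: xs) φ)
  | exAllButOne (x₀ : ℕ) (xs : List ℕ) (φ : Formula) : IsOneDim σ φ →
      (x₀ :: xs).Nodup → (x₀ :: xs).toFinset = φ.freeVars → IsOneDim σ (exBlock xs φ)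

/-- The set of sentences of the one-dimensional fragment over the binary symbols in `σ`. -/
def oneDimSentences (σ : Set BinSym) : Set Formula :=
  {φ | φ.IsOneDim σ ∧ φ.freeVars = ∅}

/-! ### A Gödel numbering of formulas

Formulas are numbered bijectively: the last octal digit of the number of a formula is its outermost
symbol, and the remaining digits number its immediate components. This fixes what it means for a
predicate on formulas to be computable. -/

/-- The Gödel number of a formula. -/
def toNat : Formula → ℕ
  | unary p x => 8 * Nat.pair p x
  | bin .succ x y => 8 * Nat.pair x y + 1
  | bin .less x y => 8 * Nat.pair x y + 2
  | bin .rel x y => 8 * Nat.pair x y + 3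
  | eq x y => 8 * Nat.pair x y + 4
  | or φ ψ => 8 * Nat.pair φ.toNat ψ.toNat + 5
  | neg φ => 8 * φ.toNat + 6
  | ex x φ => 8 * Nat.pair x φ.toNat + 7

theorem exists_toNat (n : ℕ) : ∃ φ : Formula, φ.toNat = n := by
  induction n using Nat.strong_induction_on with
  | _ n ih =>
    obtain ⟨k, r, hr, rfl⟩ : ∃ k r, r < 8 ∧ n = 8 * k + r :=
      ⟨n / 8, n % 8, Nat.mod_lt _ (by norm_num), (Nat.div_add_mod n 8).symm⟩
    have h1 := k.unpair_left_le
    have h2 := k.unpair_right_le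
    interval_cases r
    · exact ⟨unary k.unpair.1 k.unpair.2, by simp [toNat]⟩
    · exact ⟨bin .succ k.unpair.1 k.unpair.2, by simp [toNat]⟩
    · exact ⟨bin .less k.unpair.1 k.unpair.2, by simp [toNat]⟩
    · exact ⟨bin .rel k.unpair.1 k.unpair.2, by simp [toNat]⟩
    · exact ⟨eq k.unpair.1 k.unpair.2, by simp [toNat]⟩
    · obtain ⟨φ, hφ⟩ := ih k.unpair.1 (by omega)
      obtain ⟨ψ, hψ⟩ := ih k.unpair.2 (by omega)
      exact ⟨or φ ψ, by simp [toNat, hφ, hψ]⟩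
    · obtain ⟨φ, hφ⟩ := ih k (by omega)
      exact ⟨neg φ, by simp [toNat, hφ]⟩
    · obtain ⟨φ, hφ⟩ := ih k.unpair.2 (by omega)
      exact ⟨ex k.unpair.1 φ, by simp [toNat, hφ]⟩

theorem toNat_injective : Function.Injective toNat := by
  have aux {a b r : ℕ} (h : 8 * a + r = 8 * b + r) : a = b := by omega
  intro φ
  induction φ with
  | unary p x =>
    rintro (_ | ⟨_ | _ | _, _⟩ | _ | _ | _ | _) h <;> simp only [toNat] at h <;> try omega
    have := Nat.pair_eq_pair.1 (aux (r := 0) h)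
    simp [this]
  | bin s x y =>
    rcases s with _ | _ | _ <;>
    · rintro (_ | ⟨_ | _ | _, _⟩ | _ | _ | _ | _) h <;> simp only [toNat] at h <;> try omega
      have := Nat.pair_eq_pair.1 (aux h)
      simp [this]
  | eq x y =>
    rintro (_ | ⟨_ | _ | _, _⟩ | _ | _ | _ | _) h <;> simp only [toNat] at h <;> try omega
    have := Nat.pair_eq_pair.1 (aux h)
    simp [this]
  | or φ ψ ihφ ihψ =>
    rintro (_ | ⟨_ | _ | _, _⟩ | _ | _ | _ | _) h <;> simp only [toNat] at h <;> try omega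
    have := Nat.pair_eq_pair.1 (aux h)
    rw [ihφ this.1, ihψ this.2]
  | neg φ ihφ =>
    rintro (_ | ⟨_ | _ | _, _⟩ | _ | _ | _ | _) h <;> simp only [toNat] at h <;> try omega
    rw [ihφ (aux h)]
  | ex x φ ihφ =>
    rintro (_ | ⟨_ | _ | _, _⟩ | _ | _ | _ | _) h <;> simp only [toNat] at h <;> try omega
    have := Nat.pair_eq_pair.1 (aux h)
    rw [this.1, ihφ this.2]

noncomputable instance instDenumerable : Denumerable Formula :=
  Denumerable.mk' (Equiv.ofBijective toNat ⟨toNat_injective, exists_toNat⟩)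

theorem encode_eq_toNat (φ : Formula) : Encodable.encode φ = φ.toNat :=
  rfl

end Formula

/-- A structure with domain `M` interpreting the unary symbols and the binary symbols. -/
structure Interp (M : Type) where
  unary : ℕ → M → Prop
  bin : BinSym → M → M → Prop

namespace Interp

variable {M : Type}

/-- Truth of a formula under an assignment of elements to variables. -/
def Holds (I : Interp M) : (ℕ → M) → Formula → Prop
  | v, .unary p x => I.unary p (v x)
  | v, .bin s x y => I.bin s (v x) (v y)
  | v, .eq x y => v x = v y
  | v, .or φ ψ => I.Holds v φ ∨ I.Holds v ψ
  | v, .neg φ => ¬ I.Holds v φ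
  | v, .ex x φ => ∃ a : M, I.Holds (Function.update v x a) φ

/-- `I` is a model of `φ` (used for sentences, whose truth does not depend on the assignment). -/
def Models (I : Interp M) (φ : Formula) : Prop :=
  ∀ v : ℕ → M, I.Holds v φ

/-- `I` is a (finite, non-empty) word: `less` is a strict linear order and `succ` is its induced
successor relation. Nothing is required of `rel` and of the unary symbols. -/
structure IsWord (I : Interp M) : Prop where
  finite : Finite M
  nonempty : Nonempty M
  linear : IsStrictTotalOrder M (I.bin .less)
  succ_iff : ∀ a b, I.bin .succ a b ↔
    I.bin .less a b ∧ ¬ ∃ c, I.bin .less a c ∧ I.bin .less c b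

/-- `I` is an ω-word: the reduct of `I` to `succ` and `less` is isomorphic to `(ℕ, +1, <)`. Nothing
is required of `rel` and of the unary symbols. -/
def IsOmegaWord (I : Interp M) : Prop :=
  ∃ e : ℕ ≃ M, ∀ i j : ℕ,
    (I.bin .succ (e i) (e j) ↔ j = i + 1) ∧ (I.bin .less (e i) (e j) ↔ i < j)

end Interp

/-- `φ` is satisfiable over finite words (with an additional binary relation). -/
def SatOverWords (φ : Formula) : Prop :=
  ∃ (M : Type) (I : Interp M), I.IsWord ∧ I.Models φ

/-- `φ` is satisfiable over ω-words (with an additional binary relation). -/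
def SatOverOmegaWords (φ : Formula) : Prop :=
  ∃ (M : Type) (I : Interp M), I.IsOmegaWord ∧ I.Models φ

/-- The problem "given a formula in `L`, does it satisfy `S`?" is decidable: some computable
predicate on formulas answers correctly on every input from `L`. -/
def DecidableProblem (L : Set Formula) (S : Formula → Prop) : Prop :=
  ∃ p : Formula → Prop, ComputablePred p ∧ ∀ φ ∈ L, (p φ ↔ S φ)

end OneDim

/-!
Every finite structure, and every countably infinite one, becomes a word respectively an ω-word when
a suitable order is added, so sentences that mention only `rel` are satisfiable over words (ω-words)
as soon as they have some finite (countably infinite) model. On the other hand `rel` alone can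
describe computations. The models consist of configurations and half-tapes; each element points to
the half-tapes on the two sides of its cell, and each configuration to the next one. The axioms only
propagate information forward along pointers: two configurations that follow each other share or
shift their half-tapes, so no axiom has to compare tapes cell by cell, and an arbitrary model still
carries, from its start element on, representatives of the true run. Since no two elements have the
same next configuration and the start element is not next to any, a run that does not halt forces
infinitely many representatives; hence a finite model exists exactly if the machine halts. With the
additional axiom that no element is in a halting situation, a countably infinite model exists
exactly if the machine does not halt.
-/

namespace OneDim

open Turing

namespace Formula

/-- The conjunction of two formulas. -/
def and (φ ψ : Formula) : Formula := neg (or (neg φ) (neg ψ))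

/-- The universal closure of a formula, as a sentence of the one-dimensional fragment. -/
noncomputable def all (φ : Formula) : Formula :=
  neg (exBlock φ.freeVars.toList (neg φ))

theorem freeVars_exBlock (xs : List ℕ) (φ : Formula) :
    (exBlock xs φ).freeVars = φ.freeVars \ xs.toFinset := by
  induction xs with
  | nil => simp [exBlock]
  | cons x xs ih =>
    change (exBlock xs φ).freeVars.erase x = _
    rw [ih, List.toFinset_cons, Finset.sdiff_insert]

theorem freeVars_all (φ : Formula) : (all φ).freeVars = ∅ := by
  simp [all, freeVars, freeVars_exBlock]

namespace IsOneDim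

variable {σ τ : Set BinSym} {φ ψ : Formula}

theorem mono (hστ : σ ⊆ τ) (hφ : IsOneDim σ φ) : IsOneDim τ φ := by
  induction hφ with
  | unary p x => exact .unary p x
  | bin s hs x y => exact .bin s (hστ hs) x y
  | eq x y => exact .eq x y
  | or φ ψ _ _ ihφ ihψ => exact .or φ ψ ihφ ihψ
  | neg φ _ ih => exact .neg φ ih
  | exAll x xs φ _ hnodup hfree ih => exact .exAll x xs φ ih hnodup hfree
  | exAllButOne x xs φ _ hnodup hfree ih => exact .exAllButOne x xs φ ih hnodup hfree

theorem and (hφ : IsOneDim σ φ) (hψ : IsOneDim σ ψ) : IsOneDim σ (φ.and ψ) :=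
  .neg _ (.or _ _ (.neg _ hφ) (.neg _ hψ))

theorem all (hφ : IsOneDim σ φ) : IsOneDim σ (all φ) := by
  refine .neg _ ?_
  rcases hxs : φ.freeVars.toList with _ | ⟨x, xs⟩
  · exact .neg _ hφ
  · exact .exAll x xs _ (.neg _ hφ) (hxs ▸ φ.freeVars.nodup_toList)
      (by rw [← hxs, Finset.toList_toFinset, freeVars])

theorem ex_of_freeVars_eq_pair {x y : ℕ} (hφ : IsOneDim σ φ) (hxy : x ≠ y)
    (hfree : φ.freeVars = {x, y}) : IsOneDim σ (ex y φ) :=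
  .exAllButOne x [y] φ hφ (by simp [hxy]) (by simp [hfree])

theorem ex_of_freeVars_eq_singleton {x : ℕ} (hφ : IsOneDim σ φ) (hfree : φ.freeVars = {x}) :
    IsOneDim σ (ex x φ) :=
  .exAll x [] φ hφ (by simp) (by simp [hfree])

end IsOneDim

theorem oneDimSentences_mono {σ τ : Set BinSym} (hστ : σ ⊆ τ) :
    oneDimSentences σ ⊆ oneDimSentences τ :=
  fun _ hφ => ⟨hφ.1.mono hστ, hφ.2⟩

theorem and_mem_oneDimSentences {σ : Set BinSym} {φ ψ : Formula} (hφ : φ ∈ oneDimSentences σ)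
    (hψ : ψ ∈ oneDimSentences σ) : φ.and ψ ∈ oneDimSentences σ :=
  ⟨hφ.1.and hψ.1, by simp [and, freeVars, hφ.2, hψ.2]⟩

theorem primrec_neg : Primrec neg :=
  Primrec.encode_iff.1 <| (Primrec.nat_add.comp (Primrec.nat_mul.comp (.const 8) .encode)
    (.const 6)).of_eq fun _ => rfl

theorem primrec_or : Primrec₂ or :=
  Primrec₂.encode_iff.1 <| (Primrec.nat_add.comp (Primrec.nat_mul.comp (.const 8)
    (Primrec₂.natPair.comp (Primrec.encode.comp .fst) (Primrec.encode.comp .snd)))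
      (.const 5)).of_eq fun _ => rfl

theorem primrec_ex (x : ℕ) : Primrec (ex x) :=
  Primrec.encode_iff.1 <| (Primrec.nat_add.comp (Primrec.nat_mul.comp (.const 8)
    (Primrec₂.natPair.comp (.const x) .encode)) (.const 7)).of_eq fun _ => rfl

theorem primrec_and : Primrec₂ and :=
  primrec_neg.comp (primrec_or.comp (primrec_neg.comp .fst) (primrec_neg.comp .snd))

end Formula

namespace Interp

open Formula

variable {M : Type} (I : Interp M)

theorem holds_congr {φ : Formula} {v w : ℕ → M} (h : ∀ x ∈ φ.freeVars, v x = w x) :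
    I.Holds v φ ↔ I.Holds w φ := by
  induction φ generalizing v w with
  | unary p x => simp_all [Holds, freeVars]
  | bin s x y => simp_all [Holds, freeVars]
  | eq x y => simp_all [Holds, freeVars]
  | or φ ψ ihφ ihψ =>
    exact or_congr (ihφ fun x hx => h x (Finset.mem_union_left _ hx))
      (ihψ fun x hx => h x (Finset.mem_union_right _ hx))
  | neg φ ih => exact not_congr (ih h)
  | ex x φ ih =>
    refine exists_congr fun a => ih fun y hy => ?_
    by_cases hyx : y = x
    · simp [hyx]
    · simpa [hyx] using h y (Finset.mem_erase.2 ⟨hyx, hy⟩)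

theorem holds_and (v : ℕ → M) (φ ψ : Formula) :
    I.Holds v (φ.and ψ) ↔ I.Holds v φ ∧ I.Holds v ψ := by
  simp only [Formula.and, Holds, not_or, not_not]

theorem holds_exBlock (v : ℕ → M) (xs : List ℕ) (φ : Formula) :
    I.Holds v (exBlock xs φ) ↔ ∃ w : ℕ → M, (∀ y ∉ xs, w y = v y) ∧ I.Holds w φ := by
  induction xs generalizing v with
  | nil =>
    refine ⟨fun h => ⟨v, fun _ _ => rfl, h⟩, fun ⟨w, hw, h⟩ => ?_⟩
    rwa [funext fun y => hw y List.not_mem_nil] at h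
  | cons x xs ih =>
    change (∃ a : M, I.Holds (Function.update v x a) (exBlock xs φ)) ↔ _
    simp only [ih]
    constructor
    · rintro ⟨a, w, hw, h⟩
      refine ⟨w, fun y hy => ?_, h⟩
      rw [List.mem_cons, not_or] at hy
      rw [hw y hy.2, Function.update_of_ne hy.1]
    · rintro ⟨w, hw, h⟩
      refine ⟨w x, w, fun y hy => ?_, h⟩
      by_cases hyx : y = x
      · simp [hyx]
      · rw [Function.update_of_ne hyx, hw y (by simp [hyx, hy])]

theorem holds_all (v : ℕ → M) (φ : Formula) :
    I.Holds v (all φ) ↔ ∀ w : ℕ → M, I.Holds w φ := by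
  classical
  rw [all, Holds, holds_exBlock]
  constructor
  · intro h w
    by_contra hw
    refine h ⟨fun y => if y ∈ φ.freeVars then w y else v y, fun y hy => by simp_all, fun h' => ?_⟩
    exact hw ((I.holds_congr fun y hy => by simp [hy]).1 h')
  · rintro h ⟨w, -, hw⟩
    exact hw (h w)

/-- The interpretation with the same unary symbols and the same `rel` as `I`, in which `less` is
`lt` and `succ` its induced successor relation. -/
def withOrder (lt : M → M → Prop) : Interp M where
  unary := I.unary
  bin
    | .succ => fun a b => lt a b ∧ ¬ ∃ c, lt a c ∧ lt c b
    | .less => lt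
    | .rel => I.bin .rel

variable {I}

theorem holds_withOrder {lt : M → M → Prop} {φ : Formula} (hφ : IsOneDim {.rel} φ) {v : ℕ → M} :
    (I.withOrder lt).Holds v φ ↔ I.Holds v φ := by
  induction hφ generalizing v with
  | unary | eq => rfl
  | bin s hs x y => obtain rfl := hs; rfl
  | or φ ψ _ _ ihφ ihψ => exact or_congr ihφ ihψ
  | neg φ _ ih => exact not_congr ih
  | exAll _ _ _ _ _ _ ih | exAllButOne _ _ _ _ _ _ ih => simp only [holds_exBlock, ih]

end Interp

theorem satOverWords_iff {φ : Formula} (hφ : φ.IsOneDim {.rel}) :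
    SatOverWords φ ↔ ∃ (M : Type) (I : Interp M), (Finite M ∧ Nonempty M) ∧ I.Models φ := by
  constructor
  · rintro ⟨M, I, hI, h⟩
    exact ⟨M, I, ⟨hI.finite, hI.nonempty⟩, h⟩
  · rintro ⟨M, I, ⟨hfin, hne⟩, h⟩
    exact ⟨M, I.withOrder WellOrderingRel,
      ⟨hfin, hne, inferInstanceAs (IsStrictTotalOrder M WellOrderingRel), fun _ _ => Iff.rfl⟩,
      fun v => (Interp.holds_withOrder hφ).2 (h v)⟩

theorem satOverOmegaWords_iff {φ : Formula} (hφ : φ.IsOneDim {.rel}) :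
    SatOverOmegaWords φ ↔ ∃ (M : Type) (I : Interp M), (Countable M ∧ Infinite M) ∧ I.Models φ := by
  constructor
  · rintro ⟨M, I, ⟨e, -⟩, h⟩
    exact ⟨M, I, ⟨e.symm.injective.countable, .of_injective e e.injective⟩, h⟩
  · rintro ⟨M, I, ⟨hcount, hinf⟩, h⟩
    obtain ⟨e⟩ : Nonempty (ℕ ≃ M) := nonempty_equiv_of_countable
    refine ⟨M, I.withOrder fun a b => e.symm a < e.symm b, ⟨e, fun i j => ⟨?_, ?_⟩⟩,
      fun v => (Interp.holds_withOrder hφ).2 (h v)⟩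
    · simp only [Interp.withOrder, Equiv.symm_apply_apply]
      rw [← e.symm.surjective.exists (p := fun k => i < k ∧ k < j), eq_comm,
        ← Order.covBy_iff_add_one_eq, CovBy]
      simp only [not_exists, not_and]
    · simp only [Interp.withOrder, Equiv.symm_apply_apply]

instance instFiniteDir : Finite Dir :=
  .of_injective (· == .left) (by rintro (_ | _) (_ | _) <;> simp)

instance instEncodableDir : Encodable Dir :=
  .ofLeftInverse (· == .left) (fun b => if b then .left else .right) (by rintro (_ | _) <;> rfl)

/-- The opposite direction. -/
def opposite : Dir → Dir
  | .left => .right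
  | .right => .left

theorem eq_or_eq_opposite (d e : Dir) : e = d ∨ e = opposite d := by
  cases d <;> cases e <;> simp [opposite]

section Tape

variable {Γ : Type} [Inhabited Γ]

/-- The part of a tape strictly to one side of the head, read away from the head. -/
def side : Dir → Tape Γ → ListBlank Γ
  | .left => Tape.left
  | .right => Tape.right

theorem head_move (d : Dir) (T : Tape Γ) : (T.move d).head = (side d T).head := by
  cases d <;> rfl

theorem side_move_same (d : Dir) (T : Tape Γ) : side d (T.move d) = (side d T).tail := by
  cases d <;> rfl

theorem side_opposite_move (d : Dir) (T : Tape Γ) :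
    side (opposite d) (T.move d) = (side (opposite d) T).cons T.head := by
  cases d <;> rfl

theorem side_write (d : Dir) (a : Γ) (T : Tape Γ) : side d (T.write a) = side d T := by
  cases d <;> rfl

end Tape

/-- The unary symbols of the encoding of runs. An element labelled `config` is a configuration and
one labelled `half d` a half-tape, read in direction `d`. The relation `rel` goes from a
configuration to the next one, and from a configuration or a half-tape to the half-tapes that
remain beyond its first cell. The label `symbol a` gives the symbol under the head, respectively
the first symbol of a half-tape. -/
inductive Label (Γ Λ : Type) : Type
  | config | half (d : Dir) | state (q : Λ) | symbol (a : Γ) | blank | start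
  deriving Encodable

/-- A structure for the vocabulary of the encoding: one binary relation, and a unary relation for
each label. -/
structure LabelledGraph (Γ Λ D : Type) where
  rel : D → D → Prop
  lab : Label Γ Λ → D → Prop

namespace LabelledGraph

variable {Γ Λ D : Type} [Inhabited Γ] [Inhabited Λ] (G : LabelledGraph Γ Λ D)

/-- The element `x` points to `y`, and `y` has label `l`. -/
def Ptr (l : Label Γ Λ) (x y : D) : Prop := G.rel x y ∧ G.lab l y

/-- The element `y` is the configuration next to `x`, in which the state is `q` and the head reads
`a`. -/
def Step (q : Λ) (a : Γ) (x y : D) : Prop :=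
  G.lab (.state q) x ∧ G.lab (.symbol a) x ∧ G.Ptr .config x y

/-- The closure conditions that make the elements of `G` behave like configurations of the machine
`M` and their half-tapes. Only positive information is propagated: labels need not exclude each
other, and half-tapes need not be unique. -/
structure Simulates (M : TM0.Machine Γ Λ) : Prop where
  exists_half : ∀ x d, ∃ y, G.Ptr (.half d) x y
  symbol_of_blank : ∀ x, G.lab .blank x → G.lab (.symbol default) x
  blank_half : ∀ x y d, G.lab .blank x → G.Ptr (.half d) x y → G.lab .blank y
  next_injective : ∀ x y z, G.Ptr .config x z → G.Ptr .config y z → x = y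
  not_start_next : ∀ x y, G.Ptr .config x y → ¬ G.lab .start y
  exists_next : ∀ x q a, M q a ≠ none → G.lab (.state q) x → G.lab (.symbol a) x →
    ∃ y, G.Ptr .config x y
  state_next : ∀ x y q a q', (∃ s, M q a = some (q', s)) → G.Step q a x y → G.lab (.state q') y
  symbol_write : ∀ x y q a q' b, M q a = some (q', .write b) → G.Step q a x y →
    G.lab (.symbol b) y
  half_write : ∀ x y z q a d, (∃ q' b, M q a = some (q', .write b)) → G.Step q a x y →
    G.Ptr (.half d) y z → G.Ptr (.half d) x z
  symbol_move : ∀ x y z q a d b, (∃ q', M q a = some (q', .move d)) → G.Step q a x y →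
    G.Ptr (.half d) x z → G.lab (.symbol b) z → G.lab (.symbol b) y
  half_move : ∀ x y z t q a d, (∃ q', M q a = some (q', .move d)) → G.Step q a x y →
    G.Ptr (.half d) x z → G.Ptr (.half d) y t → G.Ptr (.half d) z t
  symbol_behind : ∀ x y z q a d, (∃ q', M q a = some (q', .move d)) → G.Step q a x y →
    G.Ptr (.half (opposite d)) y z → G.lab (.symbol a) z
  half_behind : ∀ x y z t q a d, (∃ q', M q a = some (q', .move d)) → G.Step q a x y →
    G.Ptr (.half (opposite d)) y z → G.Ptr (.half (opposite d)) z t →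
      G.Ptr (.half (opposite d)) x t

/-- No element represents a configuration in which `M` halts. -/
def NoHalt (M : TM0.Machine Γ Λ) : Prop :=
  ∀ x q a, M q a = none → G.lab (.state q) x → ¬ G.lab (.symbol a) x

/-- The cells from `x` on to the right spell the list `L`, followed by blanks. -/
def Spells : List Γ → D → Prop
  | [], x => G.lab (.symbol default) x ∧ ∀ y, G.Ptr (.half .right) x y → G.lab .blank y
  | a :: L, x => G.lab (.symbol a) x ∧ ∀ y, G.Ptr (.half .right) x y → Spells L y

/-- The element `x` represents the initial configuration on input `L`. -/
structure IsStart (L : List Γ) (x : D) : Prop where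
  start : G.lab .start x
  state : G.lab (.state default) x
  blank_left : ∀ y, G.Ptr (.half .left) x y → G.lab .blank y
  spells : G.Spells L x

end LabelledGraph

section Theory

variable {Γ Λ D : Type} [Encodable Γ] [Encodable Λ]

/-- The labelled graph underlying an interpretation. -/
def Interp.graph (Γ Λ : Type) [Encodable Γ] [Encodable Λ] (I : Interp D) :
    LabelledGraph Γ Λ D where
  rel := I.bin .rel
  lab l := I.unary (Encodable.encode l)

/-- A labelled graph as an interpretation. -/
def LabelledGraph.interp (G : LabelledGraph Γ Λ D) : Interp D where
  unary n x := ∃ l, Encodable.encode l = n ∧ G.lab l x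
  bin _ := G.rel

theorem LabelledGraph.graph_interp (G : LabelledGraph Γ Λ D) : G.interp.graph Γ Λ = G := by
  obtain ⟨rel, lab⟩ := G
  simp [interp, Interp.graph]

namespace Formula

/-- The atom expressing that `x` has label `l`. -/
def lab (l : Label Γ Λ) (x : ℕ) : Formula := unary (Encodable.encode l) x

/-- The formula expressing that `x` points to `y`, and `y` has label `l`. -/
def ptr (l : Label Γ Λ) (x y : ℕ) : Formula := (bin .rel x y).and (lab l y)

theorem isOneDim_ptr (l : Label Γ Λ) (x y : ℕ) : IsOneDim {.rel} (ptr l x y) :=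
  .and (.bin .rel (Set.mem_singleton _) x y) (.unary _ y)

theorem freeVars_ptr (l : Label Γ Λ) (x y : ℕ) : (ptr l x y).freeVars = {x, y} := by
  simp [ptr, and, lab, freeVars]

end Formula

theorem Interp.holds_ptr (I : Interp D) (v : ℕ → D) (l : Label Γ Λ) (x y : ℕ) :
    I.Holds v (.ptr l x y) ↔ (I.graph Γ Λ).Ptr l (v x) (v y) :=
  I.holds_and v _ _

/-- A property of assignments in labelled graphs that is expressed by a formula of the
one-dimensional fragment. -/
def Definable (P : ∀ D : Type, LabelledGraph Γ Λ D → (ℕ → D) → Prop) : Prop :=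
  ∃ φ : Formula, φ.IsOneDim {.rel} ∧
    ∀ (D : Type) (I : Interp D) (v : ℕ → D), I.Holds v φ ↔ P D (I.graph Γ Λ) v

/-- A property of labelled graphs that is expressed by a sentence of the one-dimensional
fragment. -/
def Axiomatizable (P : ∀ D : Type, LabelledGraph Γ Λ D → Prop) : Prop :=
  ∃ φ ∈ Formula.oneDimSentences {.rel},
    ∀ (D : Type) (I : Interp D) (v : ℕ → D), I.Holds v φ ↔ P D (I.graph Γ Λ)

namespace Definable

variable {P Q : ∀ D : Type, LabelledGraph Γ Λ D → (ℕ → D) → Prop}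

theorem lab (l : Label Γ Λ) (x : ℕ) : Definable fun _ G v => G.lab l (v x) :=
  ⟨_, .unary (Encodable.encode l) x, fun _ _ _ => Iff.rfl⟩

theorem eq (x y : ℕ) : Definable (Γ := Γ) (Λ := Λ) fun _ _ v => v x = v y :=
  ⟨_, .eq x y, fun _ _ _ => Iff.rfl⟩

theorem ptr (l : Label Γ Λ) (x y : ℕ) : Definable fun _ G v => G.Ptr l (v x) (v y) :=
  ⟨_, Formula.isOneDim_ptr l x y, fun _ I v => I.holds_ptr v l x y⟩

theorem exists_ptr (l : Label Γ Λ) (x : ℕ) : Definable fun _ G v => ∃ a, G.Ptr l (v x) a :=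
  ⟨_, (Formula.isOneDim_ptr l x (x + 1)).ex_of_freeVars_eq_pair (by simp)
    (Formula.freeVars_ptr l x (x + 1)), fun _ I v => by simp [Interp.Holds, Interp.holds_ptr]⟩

theorem not (hP : Definable P) : Definable fun D G v => ¬ P D G v := by
  obtain ⟨φ, hφ, h⟩ := hP
  exact ⟨_, .neg φ hφ, fun D I v => not_congr (h D I v)⟩

theorem and (hP : Definable P) (hQ : Definable Q) : Definable fun D G v => P D G v ∧ Q D G v := by
  obtain ⟨φ, hφ, h⟩ := hP
  obtain ⟨ψ, hψ, h'⟩ := hQ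
  exact ⟨_, hφ.and hψ, fun D I v => by rw [I.holds_and, h, h']⟩

theorem imp (hP : Definable P) (hQ : Definable Q) : Definable fun D G v => P D G v → Q D G v := by
  obtain ⟨φ, hφ, h⟩ := hP
  obtain ⟨ψ, hψ, h'⟩ := hQ
  exact ⟨_, .or _ _ (.neg _ hφ) hψ, fun D I v => by simp only [Interp.Holds, h, h', imp_iff_not_or]⟩

theorem true : Definable (Γ := Γ) (Λ := Λ) fun _ _ _ => True :=
  ⟨_, .eq 0 0, fun _ _ _ => by simp [Interp.Holds]⟩

theorem prop_imp (p : Prop) (hP : Definable P) : Definable fun D G v => p → P D G v := by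
  by_cases hp : p
  · simpa only [hp, forall_const] using hP
  · simpa only [hp, false_imp_iff] using true

theorem forall_finite {ι : Type} [Finite ι]
    {P : ι → ∀ D : Type, LabelledGraph Γ Λ D → (ℕ → D) → Prop} (hP : ∀ i, Definable (P i)) :
    Definable fun D G v => ∀ i, P i D G v := by
  suffices ∀ l : List ι, Definable fun D G v => ∀ i ∈ l, P i D G v by
    simpa using this Set.finite_univ.toFinset.toList
  intro l
  induction l with
  | nil => simpa using true
  | cons i l ih => simpa only [List.forall_mem_cons] using (hP i).and ih

theorem axiomatizable {Q : ∀ D : Type, LabelledGraph Γ Λ D → Prop} (hP : Definable P)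
    (hPQ : ∀ (D : Type) (G : LabelledGraph Γ Λ D), (∀ v, P D G v) ↔ Q D G) : Axiomatizable Q := by
  obtain ⟨φ, hφ, h⟩ := hP
  refine ⟨_, ⟨hφ.all, φ.freeVars_all⟩, fun D I v => ?_⟩
  simp only [I.holds_all, h, hPQ]

end Definable

namespace Axiomatizable

theorem and {P Q : ∀ D : Type, LabelledGraph Γ Λ D → Prop} (hP : Axiomatizable P)
    (hQ : Axiomatizable Q) : Axiomatizable fun D G => P D G ∧ Q D G := by
  obtain ⟨φ, hφ, h⟩ := hP
  obtain ⟨ψ, hψ, h'⟩ := hQ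
  exact ⟨_, Formula.and_mem_oneDimSentences hφ hψ, fun D I v => by rw [I.holds_and, h, h']⟩

theorem congr {P Q : ∀ D : Type, LabelledGraph Γ Λ D → Prop} (hP : Axiomatizable P)
    (hPQ : ∀ (D : Type) (G : LabelledGraph Γ Λ D), P D G ↔ Q D G) : Axiomatizable Q := by
  obtain ⟨φ, hφ, h⟩ := hP
  exact ⟨φ, hφ, fun D I v => (h D I v).trans (hPQ D _)⟩

theorem forall₁ {P : ∀ D : Type, LabelledGraph Γ Λ D → D → Prop}
    (hP : Definable fun D G v => P D G (v 0)) : Axiomatizable fun D G => ∀ x, P D G x :=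
  hP.axiomatizable fun _ _ => ⟨fun h x => h fun _ => x, fun h _ => h _⟩

theorem forall₂ {P : ∀ D : Type, LabelledGraph Γ Λ D → D → D → Prop}
    (hP : Definable fun D G v => P D G (v 0) (v 1)) : Axiomatizable fun D G => ∀ x y, P D G x y :=
  hP.axiomatizable fun _ _ => ⟨fun h x y => h fun | 0 => x | _ => y, fun h _ => h _ _⟩

theorem forall₃ {P : ∀ D : Type, LabelledGraph Γ Λ D → D → D → D → Prop}
    (hP : Definable fun D G v => P D G (v 0) (v 1) (v 2)) :
    Axiomatizable fun D G => ∀ x y z, P D G x y z :=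
  hP.axiomatizable fun _ _ => ⟨fun h x y z => h fun | 0 => x | 1 => y | _ => z, fun h _ => h _ _ _⟩

theorem forall₄ {P : ∀ D : Type, LabelledGraph Γ Λ D → D → D → D → D → Prop}
    (hP : Definable fun D G v => P D G (v 0) (v 1) (v 2) (v 3)) :
    Axiomatizable fun D G => ∀ x y z t, P D G x y z t :=
  hP.axiomatizable fun _ _ =>
    ⟨fun h x y z t => h fun | 0 => x | 1 => y | 2 => z | _ => t, fun h _ => h _ _ _ _⟩

end Axiomatizable

theorem definable_step (q : Λ) (a : Γ) : Definable fun _ G v => G.Step q a (v 0) (v 1) :=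
  (Definable.lab _ 0).and ((Definable.lab _ 0).and (.ptr _ 0 1))

theorem definable_step_imp {P : ∀ D : Type, LabelledGraph Γ Λ D → (ℕ → D) → Prop} (hP : Definable P)
    (p : Prop) (q : Λ) (a : Γ) :
    Definable fun D G v => p → G.Step q a (v 0) (v 1) → P D G v :=
  .prop_imp p (.imp (definable_step q a) hP)

open Axiomatizable in
theorem axiomatizable_simulates [Inhabited Γ] [Inhabited Λ] [Finite Γ] [Finite Λ]
    (M : TM0.Machine Γ Λ) : Axiomatizable fun _ G => G.Simulates M := by
  refine .congr ((forall₁ ?exists_half).and <| (forall₁ ?symbol_of_blank).and <|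
    (forall₂ ?blank_half).and <| (forall₃ ?next_injective).and <| (forall₂ ?not_start_next).and <|
    (forall₁ ?exists_next).and <| (forall₂ ?state_next).and <| (forall₂ ?symbol_write).and <|
    (forall₃ ?half_write).and <| (forall₃ ?symbol_move).and <| (forall₄ ?half_move).and <|
    (forall₃ ?symbol_behind).and (forall₄ ?half_behind)) fun _ _ =>
      ⟨fun ⟨h₁, h₂, h₃, h₄, h₅, h₆, h₇, h₈, h₉, h₁₀, h₁₁, h₁₂, h₁₃⟩ =>
        ⟨h₁, h₂, h₃, h₄, h₅, h₆, h₇, h₈, h₉, h₁₀, h₁₁, h₁₂, h₁₃⟩,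
       fun ⟨h₁, h₂, h₃, h₄, h₅, h₆, h₇, h₈, h₉, h₁₀, h₁₁, h₁₂, h₁₃⟩ =>
        ⟨h₁, h₂, h₃, h₄, h₅, h₆, h₇, h₈, h₉, h₁₀, h₁₁, h₁₂, h₁₃⟩⟩
  case exists_half => exact .forall_finite fun d => .exists_ptr _ 0
  case symbol_of_blank => exact .imp (.lab _ 0) (.lab _ 0)
  case blank_half => exact .forall_finite fun d => .imp (.lab _ 0) (.imp (.ptr _ 0 1) (.lab _ 1))
  case next_injective => exact .imp (.ptr _ 0 2) (.imp (.ptr _ 1 2) (.eq 0 1))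
  case not_start_next => exact .imp (.ptr _ 0 1) (.not (.lab _ 1))
  case exists_next =>
    exact .forall_finite fun q => .forall_finite fun a => .prop_imp _ <|
      .imp (.lab _ 0) (.imp (.lab _ 0) (.exists_ptr _ 0))
  case state_next =>
    exact .forall_finite fun q => .forall_finite fun a => .forall_finite fun q' =>
      definable_step_imp (.lab _ 1) _ q a
  case symbol_write =>
    exact .forall_finite fun q => .forall_finite fun a => .forall_finite fun q' =>
      .forall_finite fun b => definable_step_imp (.lab _ 1) _ q a
  case half_write =>
    exact .forall_finite fun q => .forall_finite fun a => .forall_finite fun d =>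
      definable_step_imp (.imp (.ptr _ 1 2) (.ptr _ 0 2)) _ q a
  case symbol_move =>
    exact .forall_finite fun q => .forall_finite fun a => .forall_finite fun d =>
      .forall_finite fun b =>
        definable_step_imp (.imp (.ptr _ 0 2) (.imp (.lab _ 2) (.lab _ 1))) _ q a
  case half_move =>
    exact .forall_finite fun q => .forall_finite fun a => .forall_finite fun d =>
      definable_step_imp (.imp (.ptr _ 0 2) (.imp (.ptr _ 1 3) (.ptr _ 2 3))) _ q a
  case symbol_behind =>
    exact .forall_finite fun q => .forall_finite fun a => .forall_finite fun d =>
      definable_step_imp (.imp (.ptr _ 1 2) (.lab _ 2)) _ q a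
  case half_behind =>
    exact .forall_finite fun q => .forall_finite fun a => .forall_finite fun d =>
      definable_step_imp (.imp (.ptr _ 1 2) (.imp (.ptr _ 2 3) (.ptr _ 0 3))) _ q a

theorem axiomatizable_noHalt [Inhabited Λ] [Finite Γ] [Finite Λ] (M : TM0.Machine Γ Λ) :
    Axiomatizable fun _ G => G.NoHalt M :=
  .forall₁ <| .forall_finite fun _ => .forall_finite fun _ => .prop_imp _ <|
    .imp (.lab _ 0) (.not (.lab _ 0))

namespace Formula

/-- The formula with free variable `0` saying that `φ`, which has free variable `0`, holds at all
elements with label `l` to which the element assigned to `0` points. -/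
def box (l : Label Γ Λ) (φ : Formula) : Formula :=
  neg (ex 1 (and (ptr l 0 1) (ex 0 (and (eq 0 1) (neg φ)))))

/-- The formula with free variable `0` that expresses `LabelledGraph.Spells`. -/
def spell (Λ : Type) [Encodable Λ] [Inhabited Γ] (L : List Γ) : Formula :=
  L.foldr (fun a φ => and (lab (.symbol a : Label Γ Λ) 0) (box (.half .right : Label Γ Λ) φ))
    (and (lab (.symbol default : Label Γ Λ) 0)
      (box (.half .right : Label Γ Λ) (lab (.blank : Label Γ Λ) 0)))

/-- The sentence saying that some element represents the initial configuration on input `L`. -/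
def exStart (Λ : Type) [Encodable Λ] [Inhabited Γ] [Inhabited Λ] (L : List Γ) : Formula :=
  ex 0 (and (lab (.start : Label Γ Λ) 0) (and (lab (.state default : Label Γ Λ) 0)
    (and (box (.half .left : Label Γ Λ) (lab (.blank : Label Γ Λ) 0)) (spell Λ L))))

/-- The formulas of the one-dimensional fragment over `rel` whose only free variable is `0`. -/
def unaryFormulas : Set Formula := {φ | φ.IsOneDim {.rel} ∧ φ.freeVars = {0}}

variable {φ ψ : Formula}

theorem lab_mem_unaryFormulas (l : Label Γ Λ) : lab l 0 ∈ unaryFormulas :=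
  ⟨.unary _ 0, rfl⟩

theorem and_mem_unaryFormulas (hφ : φ ∈ unaryFormulas) (hψ : ψ ∈ unaryFormulas) :
    and φ ψ ∈ unaryFormulas :=
  ⟨hφ.1.and hψ.1, by simp [and, freeVars, hφ.2, hψ.2]⟩

theorem box_mem_unaryFormulas (l : Label Γ Λ) (hφ : φ ∈ unaryFormulas) :
    box l φ ∈ unaryFormulas := by
  have hbody : (and (ptr l 0 1) (ex 0 (and (eq 0 1) (neg φ)))).freeVars = {0, 1} := by
    simp only [and, ptr, lab, freeVars, hφ.2]; rfl
  refine ⟨.neg _ (.ex_of_freeVars_eq_pair (x := 0) (.and (isOneDim_ptr l 0 1) ?_) zero_ne_one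
    hbody), by simp only [box, and, ptr, lab, freeVars, hφ.2]; rfl⟩
  exact .ex_of_freeVars_eq_pair (x := 1) (.and (.eq 0 1) (.neg φ hφ.1)) one_ne_zero
    (by simp only [and, freeVars, hφ.2]; rfl)

theorem spell_mem_unaryFormulas [Inhabited Γ] (L : List Γ) : spell Λ L ∈ unaryFormulas := by
  induction L with
  | nil =>
    exact and_mem_unaryFormulas (lab_mem_unaryFormulas _)
      (box_mem_unaryFormulas _ (lab_mem_unaryFormulas _))
  | cons a L ih =>
    exact and_mem_unaryFormulas (lab_mem_unaryFormulas _) (box_mem_unaryFormulas _ ih)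

theorem exStart_mem_oneDimSentences [Inhabited Γ] [Inhabited Λ] (L : List Γ) :
    exStart Λ L ∈ oneDimSentences {.rel} := by
  have ⟨hbody, hfree⟩ := and_mem_unaryFormulas (lab_mem_unaryFormulas (.start : Label Γ Λ)) <|
    and_mem_unaryFormulas (lab_mem_unaryFormulas (.state default : Label Γ Λ)) <|
      and_mem_unaryFormulas (box_mem_unaryFormulas (.half .left : Label Γ Λ)
        (lab_mem_unaryFormulas (.blank : Label Γ Λ))) (spell_mem_unaryFormulas (Λ := Λ) L)
  exact ⟨hbody.ex_of_freeVars_eq_singleton hfree, (congr_arg (Finset.erase · 0) hfree).trans rfl⟩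

theorem primrec_box (l : Label Γ Λ) : Primrec (box l) :=
  primrec_neg.comp <| (primrec_ex 1).comp <| primrec_and.comp (.const _) <|
    (primrec_ex 0).comp <| primrec_and.comp (.const _) primrec_neg

theorem primrec_spell {Γ : Type} [Primcodable Γ] [Inhabited Γ] [Finite Γ] :
    Primrec (spell (Γ := Γ) Λ) := by
  have hlab : Primrec fun a : Γ => lab (.symbol a : Label Γ Λ) 0 := Primrec.dom_finite _
  exact Primrec.list_foldr .id (.const _) <| Primrec.to₂ <|
    primrec_and.comp (hlab.comp (Primrec.fst.comp .snd))
      ((primrec_box _).comp (Primrec.snd.comp .snd))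

theorem primrec_exStart {Γ : Type} [Primcodable Γ] [Inhabited Γ] [Finite Γ] [Inhabited Λ] :
    Primrec (exStart (Γ := Γ) Λ) :=
  (primrec_ex 0).comp <| primrec_and.comp (.const _) <| primrec_and.comp (.const _) <|
    primrec_and.comp (.const _) primrec_spell

end Formula

namespace Interp

variable (I : Interp D)

theorem holds_box {v : ℕ → D} {l : Label Γ Λ} {φ : Formula} (hφ : φ.freeVars = {0}) :
    I.Holds v (.box l φ) ↔ ∀ y, (I.graph Γ Λ).Ptr l (v 0) y → I.Holds (fun _ => y) φ := by
  simp only [Formula.box, Holds, holds_and, holds_ptr, not_exists, not_and, not_not]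
  refine forall_congr' fun y => imp_congr (by simp) ⟨fun h => ?_, ?_⟩
  · exact (I.holds_congr (by simp [hφ])).1 (h y (by simp))
  · rintro h z hz
    refine (I.holds_congr ?_).1 h
    simpa [hφ] using hz.symm

theorem holds_spell [Inhabited Γ] {v : ℕ → D} (L : List Γ) :
    I.Holds v (.spell Λ L) ↔ (I.graph Γ Λ).Spells L (v 0) := by
  induction L generalizing v with
  | nil => exact (I.holds_and ..).trans (and_congr .rfl (I.holds_box rfl))
  | cons a L ih =>
    refine (I.holds_and ..).trans (and_congr .rfl ?_)
    refine (I.holds_box (Formula.spell_mem_unaryFormulas (Λ := Λ) L).2).trans ?_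
    simp only [ih]

theorem holds_exStart [Inhabited Γ] [Inhabited Λ] {v : ℕ → D} (L : List Γ) :
    I.Holds v (.exStart Λ L) ↔ ∃ x, (I.graph Γ Λ).IsStart L x := by
  refine exists_congr fun x => ?_
  rw [holds_and, holds_and, holds_and, holds_box _ (by rfl), holds_spell, Function.update_self]
  exact ⟨fun ⟨h₁, h₂, h₃, h₄⟩ => ⟨h₁, h₂, h₃, h₄⟩, fun ⟨h₁, h₂, h₃, h₄⟩ => ⟨h₁, h₂, h₃, h₄⟩⟩

end Interp

end Theory

section Runs

variable {Γ Λ D : Type} [Inhabited Γ] [Inhabited Λ]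

/-- The configuration of `M` after `i` steps on input `l`; it no longer changes once `M` has
halted. -/
def run (M : TM0.Machine Γ Λ) (l : List Γ) (i : ℕ) : TM0.Cfg Γ Λ :=
  (fun c => (TM0.step M c).getD c)^[i] (TM0.init l)

variable {M : TM0.Machine Γ Λ} {l : List Γ}

theorem run_succ (i : ℕ) : run M l (i + 1) = (TM0.step M (run M l i)).getD (run M l i) :=
  Function.iterate_succ_apply' ..

theorem run_succ_mem_step {i : ℕ} (h : TM0.step M (run M l i) ≠ none) :
    run M l (i + 1) ∈ TM0.step M (run M l i) := by
  obtain ⟨c, hc⟩ := Option.ne_none_iff_exists'.1 h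
  rw [run_succ, hc]
  rfl

/-- The effect of an instruction on the tape. -/
def execute : TM0.Stmt Γ → Tape Γ → Tape Γ
  | .move d => Tape.move d
  | .write a => Tape.write a

theorem step_eq_map_execute (c : TM0.Cfg Γ Λ) :
    TM0.step M c = (M c.q c.Tape.head).map fun p => ⟨p.1, execute p.2 c.Tape⟩ := by
  refine congr_arg (Option.map · _) (funext ?_)
  rintro ⟨q, _ | _⟩ <;> rfl

theorem dom_eval_iff_exists_step_run_eq_none :
    (TM0.eval M l).Dom ↔ ∃ i, TM0.step M (run M l i) = none := by
  change (StateTransition.eval (TM0.step M) (TM0.init l)).Dom ↔ _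
  simp only [Part.dom_iff_mem, StateTransition.mem_eval]
  constructor
  · rintro ⟨c, hreach, hc⟩
    suffices ∃ i, run M l i = c by
      obtain ⟨i, rfl⟩ := this
      exact ⟨i, hc⟩
    clear hc
    induction hreach with
    | refl => exact ⟨0, rfl⟩
    | tail _ hstep ih =>
      obtain ⟨i, rfl⟩ := ih
      exact ⟨i + 1, by rw [run_succ, Option.mem_def.1 hstep]; rfl⟩
  · rintro ⟨i, hi⟩
    refine ⟨run M l i, ?_, hi⟩
    clear hi
    induction i with
    | zero => exact .refl
    | succ i ih =>
      by_cases h : TM0.step M (run M l i) = none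
      · rwa [run_succ, h]
      · exact ih.tail (run_succ_mem_step h)

theorem injective_of_rel_succ {α : Type*} {r : α → α → Prop} {f : ℕ → α}
    (hr : ∀ x y z, r x z → r y z → x = y) (hzero : ∀ x, ¬ r x (f 0))
    (hsucc : ∀ i, r (f i) (f (i + 1))) : Function.Injective f := by
  intro i
  induction i with
  | zero =>
    rintro (_ | j) h
    · rfl
    · exact (hzero _ (h ▸ hsucc j)).elim
  | succ i ih =>
    rintro (_ | j) h
    · exact (hzero _ (h ▸ hsucc i)).elim
    · exact congr_arg (· + 1) (ih (hr _ _ _ (hsucc i) (h ▸ hsucc j)))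

namespace LabelledGraph

variable {G : LabelledGraph Γ Λ D} {d : Dir} {L : ListBlank Γ} {x : D} {c c' : TM0.Cfg Γ Λ}

/-- `G.HalfPath d n x y` means that `n` pointers to half-tapes with direction `d` lead from `x`
to `y`. -/
inductive HalfPath (G : LabelledGraph Γ Λ D) (d : Dir) : ℕ → D → D → Prop
  | zero (x : D) : HalfPath G d 0 x x
  | succ {n : ℕ} {x y z : D} (hxy : G.Ptr (.half d) x y) (hyz : HalfPath G d n y z) :
      HalfPath G d (n + 1) x z

/-- The symbols of `L` can be read off from `x` in direction `d`. -/
def Reads (G : LabelledGraph Γ Λ D) (d : Dir) (L : ListBlank Γ) (x : D) : Prop :=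
  ∀ n y, G.HalfPath d n x y → G.lab (.symbol (L.nth n)) y

omit [Inhabited Λ] in
theorem reads_iff : G.Reads d L x ↔
    G.lab (.symbol L.head) x ∧ ∀ y, G.Ptr (.half d) x y → G.Reads d L.tail y := by
  constructor
  · exact fun h => ⟨L.nth_zero ▸ h 0 x (.zero x),
      fun y hy n z hz => L.nth_succ n ▸ h (n + 1) z (.succ hy hz)⟩
  · rintro ⟨hhead, htail⟩ _ z (_ | ⟨hxy, hyz⟩)
    · exact L.nth_zero.symm ▸ hhead
    · exact L.nth_succ _ ▸ htail _ hxy _ _ hyz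

/-- The element `x` represents the configuration `c`. -/
structure Represents (G : LabelledGraph Γ Λ D) (c : TM0.Cfg Γ Λ) (x : D) : Prop where
  state : G.lab (.state c.q) x
  symbol : G.lab (.symbol c.Tape.head) x
  half : ∀ d y, G.Ptr (.half d) x y → G.Reads d (side d c.Tape) y

namespace Simulates

variable (hG : G.Simulates M)
include hG

theorem reads_of_blank (hx : G.lab .blank x) : G.Reads d (.mk []) x := by
  intro n y hxy
  rw [ListBlank.nth_mk, List.getI_nil]
  refine hG.symbol_of_blank y ?_
  induction hxy with
  | zero => exact hx
  | succ hxy _ ih => exact ih (hG.blank_half _ _ d hx hxy)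

theorem reads_of_spells (hx : G.Spells l x) : G.Reads .right (.mk l) x := by
  induction l generalizing x with
  | nil => exact reads_iff.2 ⟨hx.1, fun y hy => hG.reads_of_blank (hx.2 y hy)⟩
  | cons a l ih => exact reads_iff.2 ⟨hx.1, fun y hy => ih (hx.2 y hy)⟩

theorem represents_init (hx : G.IsStart l x) : G.Represents (TM0.init l) x where
  state := hx.state
  symbol := (reads_iff.1 (hG.reads_of_spells hx.spells)).1
  half
    | .left, y, hy => hG.reads_of_blank (hx.blank_left y hy)
    | .right, y, hy => (reads_iff.1 (hG.reads_of_spells hx.spells)).2 y hy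

theorem exists_next_represents (hx : G.Represents c x) (hc : c' ∈ TM0.step M c) :
    ∃ y, G.Ptr .config x y ∧ G.Represents c' y := by
  obtain ⟨q, T⟩ := c
  rw [step_eq_map_execute] at hc
  obtain ⟨⟨q', s⟩, hM, rfl⟩ := Option.map_eq_some_iff.1 hc
  obtain ⟨y, hxy⟩ := hG.exists_next x q T.head (by simp [hM]) hx.state hx.symbol
  have hstep : G.Step q T.head x y := ⟨hx.state, hx.symbol, hxy⟩
  refine ⟨y, hxy, hG.state_next x y q T.head q' ⟨s, hM⟩ hstep, ?_, ?_⟩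
  all_goals rcases s with d | b
  · obtain ⟨z, hz⟩ := hG.exists_half x d
    simp only [execute, head_move]
    exact hG.symbol_move x y z q T.head d _ ⟨q', hM⟩ hstep hz (reads_iff.1 (hx.half d z hz)).1
  · exact hG.symbol_write x y q T.head q' b hM hstep
  · intro e z hyz
    rcases eq_or_eq_opposite d e with rfl | rfl
    · obtain ⟨w, hw⟩ := hG.exists_half x e
      simp only [execute, side_move_same]
      exact (reads_iff.1 (hx.half e w hw)).2 z
        (hG.half_move x y w z q T.head e ⟨q', hM⟩ hstep hw hyz)
    · simp only [execute, side_opposite_move]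
      rw [reads_iff, ListBlank.head_cons, ListBlank.tail_cons]
      refine ⟨hG.symbol_behind x y z q T.head d ⟨q', hM⟩ hstep hyz, fun t hzt => ?_⟩
      exact hx.half _ t (hG.half_behind x y z t q T.head d ⟨q', hM⟩ hstep hyz hzt)
  · intro e z hyz
    simp only [execute, side_write]
    exact hx.half e z (hG.half_write x y z q T.head e ⟨q', b, hM⟩ hstep hyz)

theorem exists_step_run_eq_none [Finite D] (hx : G.IsStart l x) :
    ∃ i, TM0.step M (run M l i) = none := by
  by_contra! hrun
  have hnext (i : ℕ) (y : D) (hy : G.Represents (run M l i) y) :=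
    hG.exists_next_represents hy (run_succ_mem_step (hrun i))
  choose! next hptr hrep using hnext
  let f : ℕ → D := Nat.rec x next
  have hf (i : ℕ) : G.Represents (run M l i) (f i) := by
    induction i with
    | zero => exact hG.represents_init hx
    | succ i ih => exact hrep i _ ih
  exact not_injective_infinite_finite f <| injective_of_rel_succ hG.next_injective
    (fun y hy => hG.not_start_next y x hy hx.start) fun i => hptr i _ (hf i)

theorem step_run_ne_none (hhalt : G.NoHalt M) (hx : G.IsStart l x) (i : ℕ) :
    TM0.step M (run M l i) ≠ none := by
  have hstep (i : ℕ) (y : D) (hy : G.Represents (run M l i) y) : TM0.step M (run M l i) ≠ none :=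
    fun h => hhalt y _ _ (Option.map_eq_none_iff.1 h) hy.state hy.symbol
  have hrep (i : ℕ) : ∃ y, G.Represents (run M l i) y := by
    induction i with
    | zero => exact ⟨x, hG.represents_init hx⟩
    | succ i ih =>
      obtain ⟨y, hy⟩ := ih
      obtain ⟨z, -, hz⟩ := hG.exists_next_represents hy (run_succ_mem_step (hstep i y hy))
      exact ⟨z, hz⟩
  exact (hrep i).elim (hstep i)

end Simulates

end LabelledGraph

theorem finite_range_iterate_tail (L : ListBlank Γ) :
    (Set.range fun n => ListBlank.tail^[n] L).Finite := by
  induction L using ListBlank.induction_on with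
  | _ l =>
    refine (l.tails.finite_toSet.image ListBlank.mk).subset ?_
    rintro _ ⟨n, rfl⟩
    refine ⟨l.drop n, (List.mem_tails _ _).2 (List.drop_suffix n l), ?_⟩
    dsimp only
    induction n with
    | zero => rfl
    | succ n ih => rw [Function.iterate_succ_apply', ← ih, ListBlank.tail_mk, List.tail_drop]

/-- The elements of the intended models: the configurations of the run, numbered by time, and the
half-tapes, each with the direction in which it is read. -/
inductive Node (Γ : Type) [Inhabited Γ] : Type
  | config (i : ℕ)
  | half (d : Dir) (L : ListBlank Γ)

namespace Node

variable (M l)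

/-- The symbol under the head of a configuration, and the first symbol of a half-tape. -/
def symbol : Node Γ → Γ
  | config i => (run M l i).Tape.head
  | half _ L => L.head

/-- The half-tape beyond the first cell, in direction `d`. On half-tapes the value matters only for
their own direction. -/
def rest (d : Dir) : Node Γ → ListBlank Γ
  | config i => side d (run M l i).Tape
  | half _ L => L.tail

end Node

/-- The labelled graph of the configurations of the run of `M` on input `l` and of all
half-tapes. -/
def runGraph (M : TM0.Machine Γ Λ) (l : List Γ) : LabelledGraph Γ Λ (Node Γ) where
  rel
    | x, .half d L => L = x.rest M l d
    | .config i, .config j => TM0.step M (run M l i) ≠ none ∧ j = i + 1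
    | .half .., .config _ => False
  lab
    | .config, x => ∃ i, x = .config i
    | .half d, x => ∃ L, x = .half d L
    | .state q, x => ∃ i, x = .config i ∧ (run M l i).q = q
    | .symbol a, x => x.symbol M l = a
    | .blank, x => ∃ d, x = .half d (.mk [])
    | .start, x => x = .config 0

namespace runGraph

variable {q q' : Λ} {a : Γ} {x y : Node Γ}

theorem ptr_half_iff {d : Dir} : (runGraph M l).Ptr (.half d) x y ↔ y = .half d (x.rest M l d) := by
  constructor
  · rintro ⟨hxy, L, rfl⟩
    exact congr_arg (Node.half d) hxy
  · rintro rfl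
    exact ⟨rfl, _, rfl⟩

theorem ptr_config_iff : (runGraph M l).Ptr .config x y ↔
    ∃ i, TM0.step M (run M l i) ≠ none ∧ x = .config i ∧ y = .config (i + 1) := by
  constructor
  · rintro ⟨hxy, j, rfl⟩
    rcases x with i | _
    · exact ⟨i, hxy.1, rfl, congr_arg _ hxy.2⟩
    · exact hxy.elim
  · rintro ⟨i, hi, rfl, rfl⟩
    exact ⟨⟨hi, rfl⟩, _, rfl⟩

theorem exists_run_eq_of_step {s : TM0.Stmt Γ} (hM : M q a = some (q', s))
    (h : (runGraph M l).Step q a x y) : ∃ i T, x = .config i ∧ y = .config (i + 1) ∧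
      run M l i = ⟨q, T⟩ ∧ T.head = a ∧ run M l (i + 1) = ⟨q', execute s T⟩ := by
  obtain ⟨⟨i, rfl, rfl⟩, rfl, hxy⟩ := h
  obtain ⟨j, -, hj, rfl⟩ := ptr_config_iff.1 hxy
  obtain rfl := Node.config.inj hj
  refine ⟨i, (run M l i).Tape, rfl, rfl, rfl, rfl, ?_⟩
  have hM : M (run M l i).q (run M l i).Tape.head = some (q', s) := hM
  rw [run_succ, step_eq_map_execute, hM]
  rfl

theorem rest_of_step_write {b : Γ} (hM : M q a = some (q', .write b))
    (h : (runGraph M l).Step q a x y) (d : Dir) : y.rest M l d = x.rest M l d := by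
  obtain ⟨i, T, rfl, rfl, hi, -, hsucc⟩ := exists_run_eq_of_step hM h
  simp only [Node.rest, hi, hsucc, execute, side_write]

theorem symbol_of_step_move {d : Dir} (hM : M q a = some (q', .move d))
    (h : (runGraph M l).Step q a x y) : y.symbol M l = (x.rest M l d).head := by
  obtain ⟨i, T, rfl, rfl, hi, -, hsucc⟩ := exists_run_eq_of_step hM h
  simp only [Node.rest, Node.symbol, hi, hsucc, execute, head_move]

theorem rest_of_step_move {d : Dir} (hM : M q a = some (q', .move d))
    (h : (runGraph M l).Step q a x y) : y.rest M l d = (x.rest M l d).tail := by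
  obtain ⟨i, T, rfl, rfl, hi, -, hsucc⟩ := exists_run_eq_of_step hM h
  simp only [Node.rest, hi, hsucc, execute, side_move_same]

theorem rest_opposite_of_step_move {d : Dir} (hM : M q a = some (q', .move d))
    (h : (runGraph M l).Step q a x y) :
    y.rest M l (opposite d) = (x.rest M l (opposite d)).cons a := by
  obtain ⟨i, T, rfl, rfl, hi, rfl, hsucc⟩ := exists_run_eq_of_step hM h
  simp only [Node.rest, hi, hsucc, execute, side_opposite_move]

theorem exists_ptr_config (hM : M q a ≠ none) (hq : (runGraph M l).lab (.state q) x)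
    (ha : (runGraph M l).lab (.symbol a) x) : ∃ y, (runGraph M l).Ptr .config x y := by
  obtain ⟨i, rfl, rfl⟩ := hq
  obtain rfl := ha
  exact ⟨_, ptr_config_iff.2 ⟨i, mt Option.map_eq_none_iff.1 hM, rfl, rfl⟩⟩

theorem simulates (M : TM0.Machine Γ Λ) (l : List Γ) : (runGraph M l).Simulates M where
  exists_half x d := ⟨_, ptr_half_iff.2 rfl⟩
  symbol_of_blank := by
    rintro _ ⟨d, rfl⟩
    rfl
  blank_half := by
    rintro _ y d ⟨e, rfl⟩ hxy
    exact ⟨d, ptr_half_iff.1 hxy⟩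
  next_injective := by
    simp only [ptr_config_iff]
    rintro _ _ _ ⟨i, -, rfl, rfl⟩ ⟨j, -, rfl, hij⟩
    simpa using hij
  not_start_next := by
    simp only [ptr_config_iff]
    rintro _ _ ⟨i, -, rfl, rfl⟩ ⟨⟩
  exists_next _ _ _ := exists_ptr_config
  state_next := by
    rintro _ _ q a q' ⟨s, hM⟩ h
    obtain ⟨i, T, rfl, rfl, -, -, hsucc⟩ := exists_run_eq_of_step hM h
    exact ⟨i + 1, rfl, by rw [hsucc]⟩
  symbol_write := by
    rintro _ _ q a q' b hM h
    obtain ⟨i, T, rfl, rfl, -, -, hsucc⟩ := exists_run_eq_of_step hM h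
    exact congr_arg (fun c : TM0.Cfg Γ Λ => c.Tape.head) hsucc
  half_write := by
    simp only [ptr_half_iff]
    rintro x y _ q a d ⟨q', b, hM⟩ h rfl
    rw [rest_of_step_write hM h]
  symbol_move := by
    simp only [ptr_half_iff]
    rintro x y _ q a d b ⟨q', hM⟩ h rfl hb
    exact (symbol_of_step_move hM h).trans hb
  half_move := by
    simp only [ptr_half_iff]
    rintro x y _ _ q a d ⟨q', hM⟩ h rfl rfl
    rw [rest_of_step_move hM h, Node.rest]
  symbol_behind := by
    simp only [ptr_half_iff]
    rintro x y _ q a d ⟨q', hM⟩ h rfl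
    rw [rest_opposite_of_step_move hM h]
    exact ListBlank.head_cons ..
  half_behind := by
    simp only [ptr_half_iff]
    rintro x y _ _ q a d ⟨q', hM⟩ h rfl rfl
    rw [Node.rest, rest_opposite_of_step_move hM h, ListBlank.tail_cons]

theorem spells_half (L : List Γ) : (runGraph M l).Spells L (.half .right (.mk L)) := by
  induction L with
  | nil => exact ⟨rfl, fun y hy => ⟨.right, ptr_half_iff.1 hy⟩⟩
  | cons a L ih => exact ⟨rfl, fun y hy => (ptr_half_iff.1 hy).symm ▸ ih⟩

theorem isStart (M : TM0.Machine Γ Λ) (l : List Γ) : (runGraph M l).IsStart l (.config 0) where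
  start := rfl
  state := ⟨0, rfl, rfl⟩
  blank_left y hy := ⟨.left, ptr_half_iff.1 hy⟩
  spells := by
    rcases l with _ | ⟨a, l⟩
    · exact ⟨rfl, fun y hy => ⟨.right, ptr_half_iff.1 hy⟩⟩
    · exact ⟨rfl, fun y hy => (ptr_half_iff.1 hy).symm ▸ spells_half l⟩

theorem noHalt (h : ∀ i, TM0.step M (run M l i) ≠ none) : (runGraph M l).NoHalt M := by
  rintro _ _ _ hM ⟨i, rfl, rfl⟩ rfl
  exact h i (Option.map_eq_none_iff.2 hM)

/-- The nodes that occur in the run up to time `n`: its configurations and their half-tapes. -/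
def upTo (M : TM0.Machine Γ Λ) (l : List Γ) (n : ℕ) : Set (Node Γ) :=
  {x | match x with
    | .config i => i ≤ n
    | .half _ L => ∃ i ≤ n, ∃ d k, ListBlank.tail^[k] (side d (run M l i).Tape) = L}

theorem finite_upTo (n : ℕ) : (upTo M l n).Finite := by
  have hhalf : (⋃ i ∈ Set.Iic n, ⋃ (d : Dir) (e : Dir),
      Node.half e '' Set.range fun k => ListBlank.tail^[k] (side d (run M l i).Tape)).Finite :=
    (Set.finite_Iic n).biUnion fun i _ => Set.finite_iUnion fun d => Set.finite_iUnion fun e =>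
      (finite_range_iterate_tail _).image _
  refine (((Set.finite_Iic n).image Node.config).union hhalf).subset ?_
  rintro (i | ⟨e, _⟩) hx
  · exact .inl ⟨i, hx, rfl⟩
  · obtain ⟨i, hi, d, k, rfl⟩ := hx
    simp only [Set.mem_union, Set.mem_iUnion]
    exact .inr ⟨i, hi, d, e, _, ⟨k, rfl⟩, rfl⟩

theorem mem_upTo_of_rel {n : ℕ} (hn : TM0.step M (run M l n) = none) (hx : x ∈ upTo M l n)
    (hxy : (runGraph M l).rel x y) : y ∈ upTo M l n := by
  rcases x with i | ⟨e, _⟩ <;> rcases y with j | ⟨d, _⟩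
  · obtain ⟨hi, rfl⟩ := hxy
    exact lt_of_le_of_ne (show i ≤ n from hx) fun h => hi (h ▸ hn)
  · exact ⟨i, hx, d, 0, hxy.symm⟩
  · exact hxy.elim
  · obtain ⟨i, hi, e, k, rfl⟩ := hx
    exact ⟨i, hi, e, k + 1, (Function.iterate_succ_apply' ..).trans hxy.symm⟩

end runGraph

namespace LabelledGraph

variable {G : LabelledGraph Γ Λ D} {S : Set D}

/-- The labelled graph that `G` induces on `S`. -/
def induce (G : LabelledGraph Γ Λ D) (S : Set D) : LabelledGraph Γ Λ S where
  rel x y := G.rel x y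
  lab l x := G.lab l x

theorem Simulates.induce (hG : G.Simulates M) (hS : ∀ x ∈ S, ∀ y, G.rel x y → y ∈ S) :
    (G.induce S).Simulates M where
  exists_half x d := by
    obtain ⟨y, hxy⟩ := hG.exists_half x d
    exact ⟨⟨y, hS x x.2 y hxy.1⟩, hxy⟩
  symbol_of_blank x := hG.symbol_of_blank x
  blank_half x y := hG.blank_half x y
  next_injective x y z hxz hyz := Subtype.ext (hG.next_injective x y z hxz hyz)
  not_start_next x y := hG.not_start_next x y
  exists_next x q a hM hq ha := by
    obtain ⟨y, hxy⟩ := hG.exists_next x q a hM hq ha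
    exact ⟨⟨y, hS x x.2 y hxy.1⟩, hxy⟩
  state_next x y := hG.state_next x y
  symbol_write x y := hG.symbol_write x y
  half_write x y z := hG.half_write x y z
  symbol_move x y z := hG.symbol_move x y z
  half_move x y z t := hG.half_move x y z t
  symbol_behind x y z := hG.symbol_behind x y z
  half_behind x y z t := hG.half_behind x y z t

omit [Inhabited Λ] in
theorem Spells.induce {x : S} (hx : G.Spells l x) : (G.induce S).Spells l x := by
  induction l generalizing x with
  | nil => exact ⟨hx.1, fun y hy => hx.2 y hy⟩
  | cons a l ih => exact ⟨hx.1, fun y hy => ih (hx.2 y hy)⟩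

theorem IsStart.induce {x : S} (hx : G.IsStart l x) : (G.induce S).IsStart l x :=
  ⟨hx.start, hx.state, fun y => hx.blank_left y, hx.spells.induce⟩

end LabelledGraph

theorem exists_finite_graph_iff_dom_eval :
    (∃ (D : Type) (G : LabelledGraph Γ Λ D), (Finite D ∧ Nonempty D) ∧
      (∃ x, G.IsStart l x) ∧ G.Simulates M) ↔ (TM0.eval M l).Dom := by
  rw [dom_eval_iff_exists_step_run_eq_none]
  constructor
  · rintro ⟨D, G, ⟨_, -⟩, ⟨x, hx⟩, hG⟩
    exact hG.exists_step_run_eq_none hx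
  · rintro ⟨n, hn⟩
    let start : runGraph.upTo M l n := ⟨.config 0, Nat.zero_le n⟩
    exact ⟨_, (runGraph M l).induce _, ⟨runGraph.finite_upTo n, ⟨start⟩⟩,
      ⟨start, (runGraph.isStart M l).induce⟩,
      (runGraph.simulates M l).induce fun x hx y => runGraph.mem_upTo_of_rel hn hx⟩

instance instCountableNode [Countable Γ] : Countable (Node Γ) := by
  have : Countable (ListBlank Γ) := inferInstanceAs (Countable (Quotient _))
  let toSum : Node Γ → ℕ ⊕ Dir × ListBlank Γ
    | .config i => .inl i
    | .half d L => .inr (d, L)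
  refine Function.Injective.countable (f := toSum) ?_
  rintro (_ | _) (_ | _) h <;> simp_all [toSum]

theorem exists_infinite_graph_iff_not_dom_eval [Countable Γ] :
    (∃ (D : Type) (G : LabelledGraph Γ Λ D), (Countable D ∧ Infinite D) ∧
      (∃ x, G.IsStart l x) ∧ G.Simulates M ∧ G.NoHalt M) ↔ ¬ (TM0.eval M l).Dom := by
  rw [dom_eval_iff_exists_step_run_eq_none, not_exists]
  constructor
  · rintro ⟨D, G, -, ⟨x, hx⟩, hG, hhalt⟩
    exact hG.step_run_ne_none hhalt hx
  · intro h
    exact ⟨Node Γ, runGraph M l,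
      ⟨inferInstance, .of_injective Node.config fun _ _ => Node.config.inj⟩,
      ⟨_, runGraph.isStart M l⟩, runGraph.simulates M l, runGraph.noHalt h⟩

end Runs

section Halting

open PartrecToTM2

/-- The successor on binary numerals, least significant bit first. -/
def incr (l : List Γ') : List Γ' :=
  l.rec [.bit1] fun b l ih => if b = .bit0 then .bit1 :: l else .bit0 :: ih

theorem trNum_succ (m : Num) : trNum m.succ = incr (trNum m) := by
  rcases m with _ | p
  · rfl
  · change trPosNum p.succ = incr (trPosNum p)
    induction p with
    | one => rfl
    | bit1 p ih => exact congr_arg (List.cons Γ'.bit0) ih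
    | bit0 p => rfl

theorem primrec_incr [Primcodable Γ'] : Primrec incr := by
  have hstep : Primrec fun p : Γ' × List Γ' × List Γ' =>
      if p.1 = .bit0 then Γ'.bit1 :: p.2.1 else .bit0 :: p.2.2 :=
    Primrec.ite (Primrec.eq.comp .fst (.const _))
      (Primrec.list_cons.comp (.const _) (Primrec.fst.comp .snd))
      (Primrec.list_cons.comp (.const _) (Primrec.snd.comp .snd))
  exact Primrec.list_rec .id (.const _) (hstep.comp Primrec.snd).to₂

theorem primrec_trNat [Primcodable Γ'] : Primrec trNat := by
  refine (Primrec.nat_rec₁ (f := fun _ l => incr l) (trNat 0)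
    (primrec_incr.comp Primrec.snd)).of_eq fun n => ?_
  induction n with
  | zero => rfl
  | succ n ih =>
    simpa [trNat, Num.add_one, trNum_succ] using congr_arg incr ih

theorem primrec_trInit {K Γ : Type} [DecidableEq K] [Finite K] [Primcodable Γ] [Finite Γ]
    [Primcodable (TM2to1.Γ' K fun _ => Γ)] (k : K) :
    Primrec (TM2to1.trInit (Γ := fun _ => Γ) k) := by
  have : Finite (TM2to1.Γ' K fun _ => Γ) := inferInstanceAs (Finite (Bool × (K → Option Γ)))
  let cell (a : Γ) : TM2to1.Γ' K fun _ => Γ := (false, Function.update (fun _ => none) k (some a))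
  let bottom (a : TM2to1.Γ' K fun _ => Γ) : TM2to1.Γ' K fun _ => Γ := (true, a.2)
  have hcells : Primrec fun L : List Γ => L.reverse.map cell :=
    Primrec.list_map .list_reverse ((Primrec.dom_finite cell).comp Primrec.snd).to₂
  exact Primrec.list_cons.comp ((Primrec.dom_finite bottom).comp (Primrec.list_headI.comp hcells))
    (Primrec.list_tail.comp hcells)

instance instFiniteK' : Finite K' :=
  .of_surjective ![K'.main, .rev, .aux, .stack] (by
    rintro (_ | _ | _ | _)
    exacts [⟨0, rfl⟩, ⟨1, rfl⟩, ⟨2, rfl⟩, ⟨3, rfl⟩])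

open ToPartrec in
theorem exists_code_not_computable :
    ∃ c : Code, ¬ ComputablePred fun n : ℕ => (c.eval [n]).Dom := by
  have hu : Partrec fun n : ℕ => (Denumerable.ofNat Nat.Partrec.Code n).eval 0 :=
    Nat.Partrec.Code.eval_part.comp (Computable.ofNat _) (Computable.const 0)
  obtain ⟨c, hc⟩ := Code.exists_code (Nat.Partrec'.part_iff₁.2 hu)
  refine ⟨c, fun h => ComputablePred.halting_problem 0 ?_⟩
  refine ComputablePred.computable_of_manyOneReducible ⟨Encodable.encode, Computable.encode, ?_⟩ h
  intro d
  have := hc ⟨[Encodable.encode d], rfl⟩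
  dsimp only at this
  rw [this]
  simp [List.Vector.head]

theorem exists_finite_eval_dom_iff {Γ Λ : Type} [Inhabited Γ] [Inhabited Λ] {M : TM0.Machine Γ Λ}
    {S : Set Λ} [Finite S] (hM : TM0.Supports M S) :
    ∃ (Λ' : Type) (_ : Inhabited Λ') (_ : Finite Λ') (M' : TM0.Machine Γ Λ'),
      ∀ l, (TM0.eval M' l).Dom ↔ (TM0.eval M l).Dom := by
  classical
  let : Inhabited S := ⟨⟨default, hM.1⟩⟩
  let restrict : PointedMap Λ S := ⟨fun q => if h : q ∈ S then ⟨q, h⟩ else default, dif_pos hM.1⟩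
  let same : PointedMap Γ Γ := ⟨id, rfl⟩
  refine ⟨S, inferInstance, inferInstance, M.map same same restrict Subtype.val, fun l => ?_⟩
  refine StateTransition.tr_eval_dom (TM0.Machine.map_respects M same same restrict Subtype.val hM
    (fun _ => rfl) fun q hq => ?_) ⟨hM.1, ?_⟩
  · exact congr_arg Subtype.val (dif_pos hq)
  · exact (TM0.map_init same restrict l).trans (congr_arg TM0.init (List.map_id l))

theorem eval_tr_dom_iff (c : ToPartrec.Code) (v : List ℕ) :
    haveI : Inhabited Λ' := ⟨trNormal c .halt⟩
    (TM0.eval (TM1to0.tr (TM2to1.tr tr))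
      (TM2to1.trInit K'.main (trList v))).Dom ↔ (c.eval v).Dom := by
  let : Inhabited Λ' := ⟨trNormal c .halt⟩
  have hinit : TM2.init K'.main (trList v) = init c v := by
    refine congr_arg (TM2.Cfg.mk _ _) (funext ?_)
    rintro (_ | _ | _ | _) <;> rfl
  rw [TM1to0.tr_eval]
  refine (TM2to1.tr_eval_dom tr K'.main (trList v)).trans ?_
  change (StateTransition.eval _ _).Dom ↔ _
  rw [hinit]
  exact iff_of_eq (congr_arg Part.Dom (tr_eval c v))

theorem exists_machine_not_computable_dom_eval :
    ∃ (Γ Λ : Type) (_ : Primcodable Γ) (_ : Finite Γ) (_ : Inhabited Γ) (_ : Finite Λ)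
      (_ : Inhabited Λ) (M : TM0.Machine Γ Λ) (input : ℕ → List Γ), Primrec input ∧
        ¬ ComputablePred fun n => (TM0.eval M (input n)).Dom := by
  obtain ⟨c, hc⟩ := exists_code_not_computable
  let : Inhabited Λ' := ⟨trNormal c .halt⟩
  let := Fintype.ofFinite K'
  let Γ := TM2to1.Γ' K' fun _ => Γ'
  have : Finite Γ := inferInstance
  let : Primcodable Γ := .ofEquiv _ (Finite.equivFin Γ)
  let : Primcodable Γ' := .ofEquiv _ (Finite.equivFin Γ')
  obtain ⟨Λ, _, _, M, hM⟩ := exists_finite_eval_dom_iff (TM1to0.tr_supports _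
    (TM2to1.tr_supports tr (tr_supports c .halt)))
  refine ⟨Γ, Λ, inferInstance, inferInstance, inferInstance, inferInstance, inferInstance, M,
    fun n => TM2to1.trInit K'.main (trList [n]), ?_, ?_⟩
  · exact (primrec_trInit _).comp (Primrec.list_append.comp primrec_trNat (.const [Γ'.cons]))
  · simpa only [hM, eval_tr_dom_iff] using hc

end Halting

theorem not_decidableProblem_of_primrec {L : Set Formula} {S : Formula → Prop} {f : ℕ → Formula}
    {p : ℕ → Prop} (hf : Primrec f) (hL : ∀ n, f n ∈ L) (hS : ∀ n, S (f n) ↔ p n)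
    (hp : ¬ ComputablePred p) : ¬ DecidableProblem L S := by
  rintro ⟨p', hp', h⟩
  exact hp (ComputablePred.computable_of_manyOneReducible
    ⟨f, hf.to_comp, fun n => by rw [h _ (hL n), hS]⟩ hp')

theorem exists_models_exStart_and_iff {Γ Λ : Type} [Encodable Γ] [Encodable Λ] [Inhabited Γ]
    [Inhabited Λ] {P : Type → Prop} {T : ∀ D : Type, LabelledGraph Γ Λ D → Prop} {θ : Formula}
    (hP : ∀ D, P D → Nonempty D)
    (hθ : ∀ (D : Type) (I : Interp D) (v : ℕ → D), I.Holds v θ ↔ T D (I.graph Γ Λ)) (l : List Γ) :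
    (∃ (D : Type) (I : Interp D), P D ∧ I.Models ((Formula.exStart Λ l).and θ)) ↔
      ∃ (D : Type) (G : LabelledGraph Γ Λ D), P D ∧ (∃ x, G.IsStart l x) ∧ T D G := by
  simp only [Interp.Models, Interp.holds_and, Interp.holds_exStart, hθ]
  constructor
  · rintro ⟨D, I, hD, h⟩
    exact ⟨D, I.graph Γ Λ, hD, h fun _ => (hP D hD).some⟩
  · rintro ⟨D, G, hD, h⟩
    exact ⟨D, G.interp, hD, fun _ => by rwa [G.graph_interp]⟩

theorem mainTheorem5_general {σ : Set BinSym} (hσ : .rel ∈ σ) :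
    ¬ DecidableProblem (Formula.oneDimSentences σ) SatOverWords ∧
      ¬ DecidableProblem (Formula.oneDimSentences σ) SatOverOmegaWords := by
  obtain ⟨Γ, Λ, _, _, _, _, _, M, input, hinput, hM⟩ := exists_machine_not_computable_dom_eval
  let : Encodable Λ := .ofCountable Λ
  let reduction (θ : Formula) (n : ℕ) : Formula := (Formula.exStart Λ (input n)).and θ
  have hprim (θ : Formula) : Primrec (reduction θ) :=
    Formula.primrec_and.comp (Formula.primrec_exStart.comp hinput) (.const θ)
  have hmem {θ : Formula} (hθ : θ ∈ Formula.oneDimSentences {.rel}) (n : ℕ) :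
      reduction θ n ∈ Formula.oneDimSentences {.rel} :=
    Formula.and_mem_oneDimSentences (Formula.exStart_mem_oneDimSentences _) hθ
  have hmono := Formula.oneDimSentences_mono (Set.singleton_subset_iff.2 hσ)
  obtain ⟨θ, hθ, holds_θ⟩ := axiomatizable_simulates (Γ := Γ) M
  obtain ⟨η, hη, holds_η⟩ := (axiomatizable_simulates (Γ := Γ) M).and (axiomatizable_noHalt M)
  constructor
  · refine not_decidableProblem_of_primrec (hprim θ) (fun n => hmono (hmem hθ n)) (fun n => ?_) hM
    rw [satOverWords_iff (hmem hθ n).1, ← exists_finite_graph_iff_dom_eval]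
    exact exists_models_exStart_and_iff (fun _ h => h.2) holds_θ _
  · refine not_decidableProblem_of_primrec (hprim η) (fun n => hmono (hmem hη n)) (fun n => ?_)
      fun h => hM (h.not.of_eq fun n => not_not)
    rw [satOverOmegaWords_iff (hmem hη n).1, ← exists_infinite_graph_iff_not_dom_eval]
    exact exists_models_exStart_and_iff (fun _ ⟨_, _⟩ => inferInstance) holds_η _

end OneDim

theorem mainTheorem5 :
    (¬ OneDim.DecidableProblem (OneDim.Formula.oneDimSentences {.succ, .rel}) OneDim.SatOverWords ∧
      ¬ OneDim.DecidableProblem (OneDim.Formula.oneDimSentences {.succ, .rel})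
          OneDim.SatOverOmegaWords) ∧
    (¬ OneDim.DecidableProblem (OneDim.Formula.oneDimSentences {.less, .rel}) OneDim.SatOverWords ∧
      ¬ OneDim.DecidableProblem (OneDim.Formula.oneDimSentences {.less, .rel})
          OneDim.SatOverOmegaWords) :=
  ⟨OneDim.mainTheorem5_general (by simp), OneDim.mainTheorem5_general (by simp)⟩
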